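/- Let $\mathbb K\in\{\mathbb R,\mathbb C\}$. A \emph{Saks space} $(X,\|\cdot\|_X,\tau_X)$ is a Banach space $(X,\|\cdot\|_X)$ over $\mathbb K$ with a Hausdorff locally convex topology $\tau_X$ coarser than the norm topology such that $(X,\tau_X)'$ is norming, i.e. $\|x\|_X=\sup\{|x'(x)| : x'\in (X,\tau_X)',\ \|x'\|_{X'}\le 1\}$ for all $x\in X$. Its \emph{mixed topology} $\gamma_X$ is the finest linear topology that lies between $\tau_X$ and the norm topology and coincides with $\tau_X$ on norm-bounded sets. The Saks space is \emph{sequentially complete} if $(X,\gamma_X)$ is sequentially complete, and \emph{C-sequential} if every convex sequentially $\gamma_X$-open subset of $X$ is $\gamma_X$-open. A semigroup $(S_t)_{t\ge 0}$ in $\mathcal L(X)$ ($S_0=I$, $S_{s+t}=S_sS_t$) is \emph{locally $\tau_X$-bi-continuous} if (i) there are $M\ge 1$, $\omega\in\mathbb R$ with $\|S_t\|\le Me^{\omega t}$ for all $t\ge 0$; (ii) $t\mapsto S_tx\in(X,\tau_X)$ is continuous on $[0,\infty)$ for every $x\in X$; (iii) for every norm-bounded sequence $(x_n)$ in $X$ that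 $\tau_X$-converges to some $x\in X$ one has $\tau_X\text{-}\lim_{n} S_t(x_n-x)=0$ uniformly for $t$ in compact subsets of $[0,\infty)$. For a Saks space $(U,\|\cdot\|_U,\tau_U)$ and $T>0$ let $C_{\tau,b}([0,T];U)$ be the space of all $\|\cdot\|_U$-bounded functions $f\colon[0,T]\to U$ that are continuous into $(U,\tau_U)$, with the norm $\|f\|_\infty=\sup_{t\in[0,T]}\|f(t)\|_U$; let $\gamma_\infty$ be the locally convex topology on it generated by the seminorms $f\mapsto\sup_{t\in[0,T]}p(f(t))$, where $p$ runs through the $\gamma_U$-continuous seminorms on $U$. For a linear topology $\vartheta$ on $X$ and $f\colon[0,T]\to X$, the element $x\in X$ is the \emph{$\vartheta$-Pettis integral} of $f$ if for every $x'\in(X,\vartheta)'$ the function $x'\circ f$ is Lebesgue integrable on $[0,T]$ with $\int_0^T x'(f(t))\,dt=x'(x)$. Finally, let $$X^\circ=\{x'\in X' : x' \text{ is sequentially } \tau_X\text{-continuous on } \|\cdot\|_X\text{-bounded sets}\}.$$ \textbf{Proposition.} Let $(X,\|\cdot\|_X,\tau_X)$ be a sequentially complete C-sequential Saks space, $(U,\|\cdot\|_U,\tau_U)$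 a Saks space over the same field, $(S_t)_{t\ge0}$ a locally $\tau_X$-bi-continuous semigroup on $X$, and let $B\in\mathcal L(U;X)$ be also $\tau_U$-$\tau_X$-continuous on $\|\cdot\|_U$-bounded sets. (a) $(S_tB)_{t\ge0}$ is quasi-$\gamma_U$-$\gamma_X$-equicontinuous: there is $\alpha\in\mathbb R$ such that for every $\gamma_X$-neighbourhood $V$ of $0$ there is a $\gamma_U$-neighbourhood $W$ of $0$ with $e^{-\alpha t}S_tB(W)\subseteq V$ for all $t\ge0$. (b) Let $T>0$. For every $u\in C_{\tau,b}([0,T];U)$ the function $t\mapsto S_{T-t}Bu(t)$ on $[0,T]$ has a $\tau_X$-Pettis integral $\mathcal B^Tu=\int_0^TS_{T-t}Bu(t)\,dt\in X$, which is also its $\gamma_X$-Pettis integral. The map $\mathcal B^T\colon C_{\tau,b}([0,T];U)\to X$ is linear and bounded from $(C_{\tau,b}([0,T];U),\|\cdot\|_\infty)$ to $(X,\|\cdot\|_X)$, and it is also $\gamma_\infty$-$\gamma_X$-continuous. (c) For every $T>0$ and every $x^\circ\in X^\circ$, the functional $(\mathcal B^T)'x^\circ=x^\circ\circ\mathcal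 B^T$ belongs to $(C_{\tau,b}([0,T];U),\gamma_\infty)'$. -/

import Mathlib

open Set Filter Topology MeasureTheory
open scoped NNReal ENNReal

namespace SaksControl

/-- The topology of the norm. (Topologies other than the norm topology are never registered
as instances below; they are always passed explicitly.) -/
abbrev normTopology (X : Type*) [NormedAddCommGroup X] : TopologicalSpace X :=
  UniformSpace.toTopologicalSpace

/-- The linear topologies `t` on `X` which coincide with `τ` on norm-bounded sets and satisfy
`τ ⊆ t ⊆ τ_{‖·‖}` as families of open sets. (In Mathlib, `t ≤ s` means that `t` is finer.) -/
def mixedCandidates (𝕜 : Type*) {X : Type*} [RCLike 𝕜] [NormedAddCommGroup X] [NormedSpace 𝕜 X]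
    (τ : TopologicalSpace X) : Set (TopologicalSpace X) :=
  {t | @IsTopologicalAddGroup X t _ ∧ @ContinuousSMul 𝕜 X _ _ t ∧
    t ≤ τ ∧ normTopology X ≤ t ∧
    ∀ s : Set X, Bornology.IsBounded s →
      t.induced (Subtype.val : s → X) = τ.induced (Subtype.val : s → X)}

/-- The mixed topology `γ(‖·‖, τ)`: the finest of the candidates. -/
def mixedTopology (𝕜 : Type*) {X : Type*} [RCLike 𝕜] [NormedAddCommGroup X] [NormedSpace 𝕜 X]
    (τ : TopologicalSpace X) : TopologicalSpace X :=
  sInf (mixedCandidates 𝕜 τ)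

/-- The finest candidate exists, i.e. the mixed topology is itself a candidate. -/
theorem isLeast_mixedTopology (𝕜 : Type*) {X : Type*} [RCLike 𝕜] [NormedAddCommGroup X]
    [NormedSpace 𝕜 X] (τ : TopologicalSpace X) (h₁ : @IsTopologicalAddGroup X τ _)
    (h₂ : @ContinuousSMul 𝕜 X _ _ τ) (h₃ : normTopology X ≤ τ) :
    IsLeast (mixedCandidates 𝕜 τ) (mixedTopology 𝕜 τ) := by
  have hτ : τ ∈ mixedCandidates 𝕜 τ := ⟨h₁, h₂, le_rfl, h₃, fun _ _ => rfl⟩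
  refine ⟨⟨?_, ?_, sInf_le hτ, le_sInf fun t ht => ht.2.2.2.1, ?_⟩, fun t ht => sInf_le ht⟩
  · exact topologicalAddGroup_sInf fun t ht => ht.1
  · exact continuousSMul_sInf fun t ht => ht.2.1
  · intro s hs
    refine le_antisymm (induced_mono (sInf_le hτ)) ?_
    rw [mixedTopology, sInf_eq_iInf, induced_iInf]
    refine le_iInf fun t => ?_
    rw [induced_iInf]
    exact le_iInf fun ht => (ht.2.2.2.2 s hs).ge

/-- A Saks space structure on the normed space `X`: completeness of the norm together with a
coarser Hausdorff locally convex topology `tau` whose topological dual is norming, i.e.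
`‖x‖ = sup {|x'(x)| : x' ∈ (X, tau)', ‖x'‖ ≤ 1}`. -/
structure SaksSpace (𝕜 X : Type*) [RCLike 𝕜] [NormedAddCommGroup X] [NormedSpace 𝕜 X]
    [NormedSpace ℝ X] where
  tau : TopologicalSpace X
  complete : CompleteSpace X
  topologicalAddGroup : @IsTopologicalAddGroup X tau _
  continuousSMul : @ContinuousSMul 𝕜 X _ _ tau
  locallyConvex : @LocallyConvexSpace ℝ X _ _ _ _ tau
  t2 : @T2Space X tau
  norm_le_tau : normTopology X ≤ tau
  norming : ∀ x : X, IsLUB {r : ℝ | ∃ x' : X →ₗ[𝕜] 𝕜,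
    Continuous[tau, inferInstance] x' ∧ (∀ y, ‖x' y‖ ≤ ‖y‖) ∧ r = ‖x' x‖} ‖x‖

/-- The mixed topology `γ_X` of a Saks space. -/
def SaksSpace.gamma {𝕜 X : Type*} [RCLike 𝕜] [NormedAddCommGroup X] [NormedSpace 𝕜 X]
    [NormedSpace ℝ X] (𝓢 : SaksSpace 𝕜 X) : TopologicalSpace X :=
  mixedTopology 𝕜 𝓢.tau

/-- Every `γ_X`-Cauchy sequence is `γ_X`-convergent. -/
def SaksSpace.SequentiallyComplete {𝕜 X : Type*} [RCLike 𝕜] [NormedAddCommGroup X]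
    [NormedSpace 𝕜 X] [NormedSpace ℝ X] (𝓢 : SaksSpace 𝕜 X) : Prop :=
  ∀ x : ℕ → X,
    (∀ V ∈ @nhds X 𝓢.gamma 0, ∃ N : ℕ, ∀ m ≥ N, ∀ n ≥ N, x m - x n ∈ V) →
    ∃ a : X, Tendsto x atTop (@nhds X 𝓢.gamma a)

/-- Sequentially open sets: a sequence converging to a point of `s` is eventually in `s`. -/
def IsSequentiallyOpen {X : Type*} (t : TopologicalSpace X) (s : Set X) : Prop :=
  ∀ (x : ℕ → X), ∀ a ∈ s, Tendsto x atTop (@nhds X t a) → ∀ᶠ n in atTop, x n ∈ s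

/-- Every convex sequentially `γ_X`-open set is `γ_X`-open. -/
def SaksSpace.CSequential {𝕜 X : Type*} [RCLike 𝕜] [NormedAddCommGroup X] [NormedSpace 𝕜 X]
    [NormedSpace ℝ X] (𝓢 : SaksSpace 𝕜 X) : Prop :=
  ∀ s : Set X, Convex ℝ s → IsSequentiallyOpen 𝓢.gamma s → IsOpen[𝓢.gamma] s

/-- Locally `τ_X`-bi-continuous semigroups. -/
structure IsLocallyBicontinuousSemigroup {𝕜 X : Type*} [RCLike 𝕜] [NormedAddCommGroup X]
    [NormedSpace 𝕜 X] [NormedSpace ℝ X] (𝓢 : SaksSpace 𝕜 X) (S : ℝ≥0 → X →L[𝕜] X) : Prop where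
  map_zero : S 0 = ContinuousLinearMap.id 𝕜 X
  map_add : ∀ s t, S (s + t) = (S s).comp (S t)
  exponentially_bounded : ∃ M : ℝ, 1 ≤ M ∧ ∃ ω : ℝ, ∀ t : ℝ≥0, ‖S t‖ ≤ M * Real.exp (ω * t)
  strongly_continuous : ∀ x : X, Continuous[inferInstance, 𝓢.tau] fun t => S t x
  locally_bi_equicontinuous : ∀ (x : ℕ → X) (a : X), BddAbove (range fun n => ‖x n‖) →
    Tendsto x atTop (@nhds X 𝓢.tau a) →
    ∀ t₀ : ℝ≥0, ∀ V ∈ @nhds X 𝓢.tau 0, ∀ᶠ n in atTop, ∀ t ≤ t₀, S t (x n - a) ∈ V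

/-- `B` is `τ_U`-`τ_X`-continuous on norm-bounded sets. -/
def ContinuousOnBounded {𝕜 U X : Type*} [RCLike 𝕜] [NormedAddCommGroup U] [NormedSpace 𝕜 U]
    [NormedSpace ℝ U] [NormedAddCommGroup X] [NormedSpace 𝕜 X] [NormedSpace ℝ X]
    (𝓢U : SaksSpace 𝕜 U) (𝓢X : SaksSpace 𝕜 X) (B : U →L[𝕜] X) : Prop :=
  ∀ M : Set U, Bornology.IsBounded M → @ContinuousOn U X 𝓢U.tau 𝓢X.tau B M

/-- A family `(F_t)_{t ≥ 0}` of linear maps is quasi-`tU`-`tX`-equicontinuous if for some real `α`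
the family `(e^{-αt} F_t)_{t ≥ 0}` is equicontinuous for the linear topologies `tU` and `tX`. -/
def QuasiEquicontinuous {𝕜 U X : Type*} [RCLike 𝕜] [AddCommGroup U] [Module 𝕜 U]
    [AddCommGroup X] [Module 𝕜 X] (tU : TopologicalSpace U) (tX : TopologicalSpace X)
    (F : ℝ≥0 → U →ₗ[𝕜] X) : Prop :=
  ∃ α : ℝ, ∀ V ∈ @nhds X tX 0, ∃ W ∈ @nhds U tU 0,
    ∀ (t : ℝ≥0), ∀ u ∈ W, ((Real.exp (-α * t) : ℝ) : 𝕜) • F t u ∈ V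

/-- `C_{τ,b}([0,T];U)`: the bounded functions `[0,T] → U` (with the supremum norm) which are
continuous into `(U, τ_U)`. -/
def Ctb {𝕜 U : Type*} [RCLike 𝕜] [NormedAddCommGroup U] [NormedSpace 𝕜 U] [NormedSpace ℝ U]
    (𝓢 : SaksSpace 𝕜 U) (T : ℝ) : Submodule 𝕜 (lp (fun _ : Icc (0 : ℝ) T => U) ∞) where
  carrier := {f | Continuous[inferInstance, 𝓢.tau] fun t : Icc (0 : ℝ) T => f t}
  zero_mem' := @continuous_const _ _ _ 𝓢.tau 0
  add_mem' {f g} hf hg := by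
    let _ := 𝓢.tau
    have := 𝓢.topologicalAddGroup
    exact Continuous.add (f := fun t => f t) (g := fun t => g t) hf hg
  smul_mem' c f hf := by
    let _ := 𝓢.tau
    have := 𝓢.continuousSMul
    exact Continuous.const_smul (g := fun t => f t) hf c

/-- Evaluation at `t`. -/
def Ctb.eval {𝕜 U : Type*} [RCLike 𝕜] [NormedAddCommGroup U] [NormedSpace 𝕜 U] [NormedSpace ℝ U]
    (𝓢 : SaksSpace 𝕜 U) (T : ℝ) (t : Icc (0 : ℝ) T) : Ctb 𝓢 T →ₗ[𝕜] U where
  toFun f := (f : lp (fun _ : Icc (0 : ℝ) T => U) ∞) t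
  map_add' _ _ := rfl
  map_smul' _ _ := rfl

/-- The seminorm `f ↦ sup_{t ∈ [0,T]} p(f(t))`, for seminorms `p` that are continuous for the
norm. -/
noncomputable def Ctb.supSeminorm {𝕜 U : Type*} [RCLike 𝕜] [NormedAddCommGroup U]
    [NormedSpace 𝕜 U] [NormedSpace ℝ U] (𝓢 : SaksSpace 𝕜 U) (T : ℝ) (p : Seminorm 𝕜 U) :
    Seminorm 𝕜 (Ctb 𝓢 T) :=
  ⨆ t : Icc (0 : ℝ) T, p.comp (Ctb.eval 𝓢 T t)

theorem SaksSpace.norm_le_gamma {𝕜 U : Type*} [RCLike 𝕜] [NormedAddCommGroup U]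
    [NormedSpace 𝕜 U] [NormedSpace ℝ U] (𝓢 : SaksSpace 𝕜 U) : normTopology U ≤ 𝓢.gamma :=
  le_sInf fun _ ht => ht.2.2.2.1

theorem Ctb.supSeminorm_apply {𝕜 U : Type*} [RCLike 𝕜] [NormedAddCommGroup U]
    [NormedSpace 𝕜 U] [NormedSpace ℝ U] (𝓢 : SaksSpace 𝕜 U) (T : ℝ) (p : Seminorm 𝕜 U)
    (hp : Continuous[𝓢.gamma, inferInstance] p) (f : Ctb 𝓢 T) :
    Ctb.supSeminorm 𝓢 T p f = ⨆ t, p (Ctb.eval 𝓢 T t f) := by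
  have hp' : Continuous p := continuous_le_dom 𝓢.norm_le_gamma hp
  obtain ⟨C, hC0, hC⟩ := Seminorm.bound_of_continuous_normedSpace p hp'
  have hb : BddAbove (range fun t : Icc (0 : ℝ) T => p.comp (Ctb.eval 𝓢 T t)) := by
    rw [Seminorm.bddAbove_range_iff]
    intro g
    refine ⟨C * ‖(g : lp (fun _ : Icc (0 : ℝ) T => U) ∞)‖, ?_⟩
    rintro _ ⟨t, rfl⟩
    have hgt : ‖Ctb.eval 𝓢 T t g‖ ≤ ‖(g : lp (fun _ : Icc (0 : ℝ) T => U) ∞)‖ :=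
      lp.norm_apply_le_norm (E := fun _ : Icc (0 : ℝ) T => U) ENNReal.top_ne_zero _ _
    exact (hC _).trans (mul_le_mul_of_nonneg_left hgt hC0.le)
  exact Seminorm.iSup_apply hb

/-- The locally convex topology `γ_∞` on `C_{τ,b}([0,T];U)`, generated by the seminorms
`f ↦ sup_{t ∈ [0,T]} p(f(t))` where `p` runs through the `γ_U`-continuous seminorms. -/
noncomputable def gammaInfty {𝕜 U : Type*} [RCLike 𝕜] [NormedAddCommGroup U] [NormedSpace 𝕜 U]
    [NormedSpace ℝ U] (𝓢 : SaksSpace 𝕜 U) (T : ℝ) : TopologicalSpace (Ctb 𝓢 T) :=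
  (SeminormFamily.moduleFilterBasis (𝕜 := 𝕜)
    (fun p : {p : Seminorm 𝕜 U // Continuous[𝓢.gamma, inferInstance] p} =>
      Ctb.supSeminorm 𝓢 T p.1)).topology

/-- `x` is the `t`-Pettis integral of `f` with respect to `μ`: for each `t`-continuous linear
functional `x'`, the scalar function `x' ∘ f` is integrable, with integral `x' x`. -/
def HasPettisIntegral (𝕜 : Type*) {Ω X : Type*} [RCLike 𝕜] [AddCommGroup X] [Module 𝕜 X]
    [MeasurableSpace Ω] (t : TopologicalSpace X) (μ : Measure Ω) (f : Ω → X) (x : X) : Prop :=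
  ∀ x' : X →ₗ[𝕜] 𝕜, Continuous[t, inferInstance] x' →
    Integrable (fun ω => x' (f ω)) μ ∧ ∫ ω, x' (f ω) ∂μ = x' x

open Classical in
/-- The `t`-Pettis integral of `f`; it is `0` if `f` is not `t`-Pettis integrable. -/
noncomputable def pettisIntegral (𝕜 : Type*) {Ω X : Type*} [RCLike 𝕜] [AddCommGroup X]
    [Module 𝕜 X] [MeasurableSpace Ω] (t : TopologicalSpace X) (μ : Measure Ω) (f : Ω → X) : X :=
  if h : ∃ x, HasPettisIntegral 𝕜 t μ f x then h.choose else 0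

/-- Lebesgue measure on `[0,T]`. -/
noncomputable def lebesgueIcc (T : ℝ) : Measure (Icc (0 : ℝ) T) :=
  (volume : Measure ℝ).comap Subtype.val

/-- The integrand `t ↦ S_{T-t} B u(t)` on `[0,T]`. -/
noncomputable def inputIntegrand {𝕜 U X : Type*} [RCLike 𝕜] [NormedAddCommGroup U] [NormedSpace 𝕜 U]
    [NormedSpace ℝ U] [NormedAddCommGroup X] [NormedSpace 𝕜 X]
    (𝓢U : SaksSpace 𝕜 U) (S : ℝ≥0 → X →L[𝕜] X) (B : U →L[𝕜] X) (T : ℝ) (u : Ctb 𝓢U T) :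
    Icc (0 : ℝ) T → X :=
  fun t => S ⟨T - t, sub_nonneg.2 t.2.2⟩ (B (Ctb.eval 𝓢U T t u))

/-- The input map `𝓑^T u = ∫_0^T S_{T-t} B u(t) dt` as a `τ_X`-Pettis integral with respect to
Lebesgue measure on `[0,T]`. -/
noncomputable def inputMap {𝕜 U X : Type*} [RCLike 𝕜] [NormedAddCommGroup U] [NormedSpace 𝕜 U]
    [NormedSpace ℝ U] [NormedAddCommGroup X] [NormedSpace 𝕜 X] [NormedSpace ℝ X]
    (𝓢U : SaksSpace 𝕜 U) (𝓢X : SaksSpace 𝕜 X) (S : ℝ≥0 → X →L[𝕜] X) (B : U →L[𝕜] X) (T : ℝ)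
    (u : Ctb 𝓢U T) : X :=
  pettisIntegral 𝕜 𝓢X.tau (lebesgueIcc T) (inputIntegrand 𝓢U S B T u)

/-- `X°`: the bounded linear functionals which are sequentially `τ_X`-continuous on norm-bounded
sets. -/
def SaksSpace.circDual {𝕜 X : Type*} [RCLike 𝕜] [NormedAddCommGroup X] [NormedSpace 𝕜 X]
    [NormedSpace ℝ X] (𝓢 : SaksSpace 𝕜 X) : Set (X →L[𝕜] 𝕜) :=
  {x' | ∀ (x : ℕ → X) (a : X), BddAbove (range fun n => ‖x n‖) →
    Tendsto x atTop (@nhds X 𝓢.tau a) → Tendsto (fun n => x' (x n)) atTop (𝓝 (x' a))}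

end SaksControl

namespace SaksControl

/-! ### Balanced convex neighbourhoods. -/

section LocallyConvex

variable {𝕜 X : Type*} [RCLike 𝕜] [AddCommGroup X] [Module 𝕜 X] [Module ℝ X] [IsScalarTower ℝ 𝕜 X]

/-! The mixed topology `γ` is handled through its continuous seminorms. Since `γ` is the finest
candidate, a seminorm is `γ`-continuous once it is `τ`-continuous at `0` on every ball
(`SaksSpace.continuous_gamma_seminorm`). Two constructions rest on this test: `γ` is locally convex
(`SaksSpace.exists_seminorm_gamma`), and `γ`-convergent sequences are norm-bounded, because `τ` has
a norming dual (`SaksSpace.exists_norm_le_of_tendsto_gamma`).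

For a `γ`-continuous seminorm `q`, consider `p x = sup_t e^{-αt} q(S_t x)` with `α` larger than the
exponential growth bound. Along a `γ`-null sequence large times are controlled by the norm bound and
small times by bi-equicontinuity, so `p` is sequentially continuous, hence continuous by
C-sequentiality. This is quasi-equicontinuity of the semigroup; composing with `B` gives (a).

With (a) the integrand is `γ`-continuous and norm-bounded. Its integral is the `γ`-limit of Bochner
integrals of simple approximations, a Cauchy sequence by dominated convergence. The limit satisfies
`q x ≤ ∫ q(f)`, which with equicontinuity gives the continuity in (b); the norm bound comes from the
norming dual. Finally C-sequentiality makes every element of `X°` `γ`-continuous, so (c) is a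
composition. -/

theorem balanced_convexHull {s : Set X} (hs : Balanced 𝕜 s) : Balanced 𝕜 (convexHull ℝ s) := by
  rw [balanced_iff_smul_mem] at hs ⊢
  intro a ha x hx
  have hc : Convex ℝ {x : X | a • x ∈ convexHull ℝ s} := by
    intro x hx y hy c d hc hd hcd
    have := convex_convexHull ℝ s hx hy hc hd hcd
    simpa only [mem_ofPred_eq, smul_add, smul_comm a c, smul_comm a d] using this
  exact convexHull_min (t := {x : X | a • x ∈ convexHull ℝ s})
    (fun y hy => show a • y ∈ _ from subset_convexHull ℝ s (hs ha hy)) hc hx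

/-- Shrinking a convex neighbourhood to a balanced one may destroy convexity; the convex hull
restores it, keeps balancedness and stays inside the original convex set. -/
theorem exists_balanced_convex_mem_nhds [TopologicalSpace X] [ContinuousSMul 𝕜 X]
    [IsTopologicalAddGroup X] [LocallyConvexSpace ℝ X] {V : Set X} (hV : V ∈ 𝓝 (0 : X)) :
    ∃ W ∈ 𝓝 (0 : X), Balanced 𝕜 W ∧ Convex ℝ W ∧ W ⊆ V := by
  obtain ⟨C, ⟨hC, hCc⟩, hCV⟩ := (LocallyConvexSpace.convex_basis (𝕜 := ℝ) (0 : X)).mem_iff.1 hV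
  obtain ⟨D, ⟨hD, hDb⟩, hDC⟩ := (nhds_basis_balanced 𝕜 X).mem_iff.1 hC
  exact ⟨convexHull ℝ D, mem_of_superset hD (subset_convexHull ℝ D), balanced_convexHull hDb,
    convex_convexHull ℝ D, (convexHull_min hDC hCc).trans hCV⟩

end LocallyConvex

/-! ### The mixed topology on bounded sets and its continuous seminorms. -/

section Mixed

variable {𝕜 X : Type*} [RCLike 𝕜] [NormedAddCommGroup X] [NormedSpace 𝕜 X] [NormedSpace ℝ X]

theorem SaksSpace.gamma_mem_candidates (𝓢 : SaksSpace 𝕜 X) :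
    𝓢.gamma ∈ mixedCandidates 𝕜 𝓢.tau :=
  (isLeast_mixedTopology 𝕜 𝓢.tau 𝓢.topologicalAddGroup 𝓢.continuousSMul 𝓢.norm_le_tau).1

theorem SaksSpace.isTopologicalAddGroup_gamma (𝓢 : SaksSpace 𝕜 X) :
    @IsTopologicalAddGroup X 𝓢.gamma _ :=
  𝓢.gamma_mem_candidates.1

theorem SaksSpace.continuousSMul_gamma (𝓢 : SaksSpace 𝕜 X) :
    @ContinuousSMul 𝕜 X _ _ 𝓢.gamma :=
  𝓢.gamma_mem_candidates.2.1

theorem SaksSpace.gamma_le_tau (𝓢 : SaksSpace 𝕜 X) : 𝓢.gamma ≤ 𝓢.tau :=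
  𝓢.gamma_mem_candidates.2.2.1

theorem SaksSpace.nhdsWithin_gamma (𝓢 : SaksSpace 𝕜 X) {s : Set X} (hs : Bornology.IsBounded s)
    {a : X} (ha : a ∈ s) : @nhdsWithin X 𝓢.gamma a s = @nhdsWithin X 𝓢.tau a s := by
  have h := 𝓢.gamma_mem_candidates.2.2.2.2 s hs
  have h1 := @map_nhds_subtype_val X 𝓢.gamma s ⟨a, ha⟩
  have h2 := @map_nhds_subtype_val X 𝓢.tau s ⟨a, ha⟩
  rw [← h1, ← h2]
  unfold instTopologicalSpaceSubtype
  rw [h]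

/-- A filter limit inside a norm-bounded set may be tested for `tau` instead of `gamma`. -/
theorem SaksSpace.tendsto_gamma (𝓢 : SaksSpace 𝕜 X) {α : Type*} {l : Filter α} {x : α → X} {a : X}
    {R : ℝ} (hR : ∀ i, ‖x i‖ ≤ R) (h : Tendsto x l (@nhds X 𝓢.tau a)) :
    Tendsto x l (@nhds X 𝓢.gamma a) := by
  have ha : a ∈ insert a (range x) := mem_insert _ _
  have hs : Bornology.IsBounded (insert a (range x)) := by
    refine Bornology.IsBounded.insert ?_ a
    exact (isBounded_iff_forall_norm_le.2 ⟨R, by rintro _ ⟨i, rfl⟩; exact hR i⟩)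
  have h1 : Tendsto x l (@nhdsWithin X 𝓢.tau a (insert a (range x))) :=
    tendsto_inf.2 ⟨h, tendsto_principal.2 (Eventually.of_forall fun i => Or.inr ⟨i, rfl⟩)⟩
  rw [← 𝓢.nhdsWithin_gamma hs ha] at h1
  exact h1.mono_right inf_le_left

theorem SaksSpace.exists_nhds_tau (𝓢 : SaksSpace 𝕜 X) {V : Set X} (hV : V ∈ @nhds X 𝓢.gamma 0)
    (R : ℝ) : ∃ W ∈ @nhds X 𝓢.tau 0, ∀ x ∈ W, ‖x‖ ≤ R → x ∈ V := by
  -- The absolute value keeps `0` in the ball when `R` is negative.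
  have ha : (0 : X) ∈ Metric.closedBall (0 : X) |R| := by simp
  have h : V ∈ @nhdsWithin X 𝓢.gamma 0 (Metric.closedBall 0 |R|) :=
    (inf_le_left : @nhdsWithin X 𝓢.gamma 0 (Metric.closedBall 0 |R|) ≤ _) hV
  rw [𝓢.nhdsWithin_gamma Metric.isBounded_closedBall ha] at h
  obtain ⟨W, hW, h⟩ := (@mem_nhdsWithin_iff_exists_mem_nhds_inter X 𝓢.tau _ _ _).1 h
  exact ⟨W, hW, fun x hx hR => h ⟨hx, by simpa using hR.trans (le_abs_self R)⟩⟩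

theorem tendsto_sub_nhds_zero {X : Type*} [AddCommGroup X] (t : TopologicalSpace X)
    [IsTopologicalAddGroup X] (a : X) : Tendsto (fun x => x - a) (𝓝 a) (𝓝 0) := by
  simpa using (tendsto_id (x := 𝓝 a)).sub_const a

theorem tendsto_add_nhds_zero {X : Type*} [AddCommGroup X] (t : TopologicalSpace X)
    [IsTopologicalAddGroup X] (a : X) : Tendsto (fun x => x + a) (𝓝 0) (𝓝 a) := by
  simpa using (tendsto_id (x := 𝓝 (0 : X))).add_const a

/-- A seminorm is continuous for the mixed topology as soon as it is continuous at `0` for `tau`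
on every ball. -/
theorem SaksSpace.continuous_gamma_seminorm (𝓢 : SaksSpace 𝕜 X) (q : Seminorm 𝕜 X)
    (hq : ∀ R : ℝ, ∀ ε > 0, ∃ W ∈ @nhds X 𝓢.tau 0, ∀ x ∈ W, ‖x‖ ≤ R → q x < ε) :
    Continuous[𝓢.gamma, inferInstance] q := by
  let Q : SeminormFamily 𝕜 X Unit := fun _ => q
  have hQ : @WithSeminorms 𝕜 X Unit _ _ _ Q Q.moduleFilterBasis.topology :=
    @WithSeminorms.mk 𝕜 X Unit _ _ _ Q Q.moduleFilterBasis.topology rfl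
  have hsub : ∀ a, Tendsto (fun x => x - a) (@nhds X 𝓢.tau a) (@nhds X 𝓢.tau 0) := fun a =>
    @tendsto_sub_nhds_zero X _ 𝓢.tau 𝓢.topologicalAddGroup a
  -- Adjoining `q` to `τ` changes nothing on bounded sets, so the result is a candidate and `γ`, the
  -- finest one, makes `q` continuous.
  have hmem : 𝓢.tau ⊓ Q.moduleFilterBasis.topology ∈ mixedCandidates 𝕜 𝓢.tau := by
    refine ⟨?_, ?_, inf_le_left, ?_, ?_⟩
    · exact @topologicalAddGroup_inf X _ _ _ 𝓢.topologicalAddGroup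
        (@WithSeminorms.topologicalAddGroup 𝕜 X Unit _ _ _ Q.moduleFilterBasis.topology Q hQ)
    · exact @continuousSMul_inf 𝕜 X _ _ _ _ 𝓢.continuousSMul
        (@WithSeminorms.continuousSMul 𝕜 X Unit _ _ _ Q.moduleFilterBasis.topology Q hQ)
    · refine le_inf 𝓢.norm_le_tau (le_of_nhds_le_nhds fun a => ?_)
      refine (@WithSeminorms.tendsto_nhds 𝕜 X X Unit _ _ _ Q.moduleFilterBasis.topology Q hQ id _ a).2 fun _ ε hε => ?_
      obtain ⟨W, hW, h⟩ := hq 1 ε hε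
      have h1 := nhds_mono 𝓢.norm_le_tau (hsub a hW)
      have h2 : ∀ᶠ x in 𝓝 a, ‖x - a‖ ≤ 1 := by
        filter_upwards [Metric.closedBall_mem_nhds a one_pos] with x hx
        rwa [mem_closedBall_iff_norm] at hx
      filter_upwards [h1, h2] with x hx hx' using h _ hx hx'
    · intro s hs
      refine le_antisymm (induced_mono inf_le_left) ?_
      rw [induced_inf]
      refine le_inf le_rfl (le_of_nhds_le_nhds fun a => ?_)
      rw [@nhds_induced _ _ Q.moduleFilterBasis.topology, @nhds_induced _ _ 𝓢.tau, ← map_le_iff_le_comap]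
      refine (@WithSeminorms.tendsto_nhds 𝕜 X _ Unit _ _ _ Q.moduleFilterBasis.topology Q hQ Subtype.val _ a.1).2
        fun _ ε hε => ?_
      obtain ⟨R, hR⟩ := hs.exists_norm_le
      -- Differences of two points of `s` have norm at most `R + R`.
      obtain ⟨W, hW, h⟩ := hq (R + R) ε hε
      filter_upwards [preimage_mem_comap (hsub a.1 hW)] with x hx
      exact h _ hx ((norm_sub_le _ _).trans (add_le_add (hR _ x.2) (hR _ a.2)))
  have h1 : 𝓢.gamma ≤ Q.moduleFilterBasis.topology := (sInf_le hmem).trans inf_le_right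
  exact continuous_le_dom h1 (@WithSeminorms.continuous_seminorm 𝕜 X Unit _ _ _ Q.moduleFilterBasis.topology Q hQ ())

theorem SaksSpace.continuous_seminorm_of_gamma (𝓢 : SaksSpace 𝕜 X) {q : Seminorm 𝕜 X}
    (hq : Continuous[𝓢.gamma, inferInstance] q) : Continuous q :=
  continuous_le_dom 𝓢.norm_le_gamma hq

theorem SaksSpace.seminorm_lt_mem_nhds (𝓢 : SaksSpace 𝕜 X) {q : Seminorm 𝕜 X}
    (hq : Continuous[𝓢.gamma, inferInstance] q) {ε : ℝ} (hε : 0 < ε) :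
    {x | q x < ε} ∈ @nhds X 𝓢.gamma 0 := by
  have h := @Continuous.tendsto X ℝ 𝓢.gamma _ _ hq 0
  rw [_root_.map_zero] at h
  exact h.eventually_lt_const hε

end Mixed

/-! ### Local convexity of the mixed topology and norm-boundedness. -/

section Mixed

open scoped Pointwise

variable {𝕜 X : Type*} [RCLike 𝕜] [NormedAddCommGroup X] [NormedSpace 𝕜 X] [NormedSpace ℝ X]

/-- Split off the first term: it lies in `V (m + 1)`, and so does the rest by induction, which is
why `m` must vary. -/
theorem sum_range_mem_of_add_subset {X : Type*} [AddCommMonoid X] {V : ℕ → Set X}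
    (h0 : ∀ k, (0 : X) ∈ V k) (hV : ∀ k, V (k + 1) + V (k + 1) ⊆ V k) (n : ℕ) :
    ∀ (m : ℕ) (f : ℕ → X), (∀ k, f k ∈ V (m + k + 1)) → ∑ k ∈ Finset.range n, f k ∈ V m := by
  induction n with
  | zero => intro m f _; simpa using h0 m
  | succ n ih =>
    intro m f hf
    rw [Finset.sum_range_succ']
    refine hV m (add_mem_add (ih (m + 1) (fun k => f (k + 1)) fun k => ?_) (hf 0))
    have := hf (k + 1)
    rwa [show m + (k + 1) + 1 = m + 1 + k + 1 by ring] at this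

/-- The set of all finite sums `∑ x_k` with `x_k ∈ K k`. -/
def finiteSums {X : Type*} [AddCommMonoid X] (K : ℕ → Set X) : Set X :=
  {x | ∃ f : ℕ →₀ X, (∀ k, f k ∈ K k) ∧ f.sum (fun _ y => y) = x}

theorem subset_finiteSums {X : Type*} [AddCommMonoid X] {K : ℕ → Set X}
    (h0 : ∀ k, (0 : X) ∈ K k) (k : ℕ) : K k ⊆ finiteSums K := by
  intro x hx
  refine ⟨Finsupp.single k x, fun j => ?_, by simp⟩
  rcases eq_or_ne k j with rfl | h
  · simpa using hx
  · simpa [Finsupp.single_eq_of_ne' h] using h0 j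

theorem balanced_finiteSums {𝕜 X : Type*} [RCLike 𝕜] [AddCommGroup X] [Module 𝕜 X]
    {K : ℕ → Set X} (hK : ∀ k, Balanced 𝕜 (K k)) : Balanced 𝕜 (finiteSums K) := by
  rw [balanced_iff_smul_mem]
  rintro a ha _ ⟨f, hf, rfl⟩
  refine ⟨a • f, fun k => (balanced_iff_smul_mem.1 (hK k)) ha (hf k), ?_⟩
  rw [Finsupp.sum_smul_index' (by simp), Finsupp.smul_sum]

theorem convex_finiteSums {X : Type*} [AddCommGroup X] [Module ℝ X]
    {K : ℕ → Set X} (hK : ∀ k, Convex ℝ (K k)) : Convex ℝ (finiteSums K) := by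
  rintro _ ⟨f, hf, rfl⟩ _ ⟨g, hg, rfl⟩ a b ha hb hab
  refine ⟨a • f + b • g, fun k => hK k (hf k) (hg k) ha hb hab, ?_⟩
  rw [Finsupp.sum_add_index' (by simp) (by simp), Finsupp.sum_smul_index' (by simp),
    Finsupp.sum_smul_index' (by simp), Finsupp.smul_sum, Finsupp.smul_sum]

theorem finiteSums_subset {X : Type*} [AddCommMonoid X] {V K : ℕ → Set X}
    (h0 : ∀ k, (0 : X) ∈ V k) (hV : ∀ k, V (k + 1) + V (k + 1) ⊆ V k)
    (hK : ∀ k, K k ⊆ V (k + 1)) : finiteSums K ⊆ V 0 := by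
  rintro _ ⟨f, hf, rfl⟩
  obtain ⟨n, hn⟩ := f.support.exists_nat_subset_range
  rw [Finsupp.sum_of_support_subset f hn _ (by simp)]
  exact sum_range_mem_of_add_subset h0 hV n 0 f fun k => by simpa using hK k (hf k)

/-- The mixed topology is locally convex. -/
theorem SaksSpace.exists_seminorm_gamma [IsScalarTower ℝ 𝕜 X] (𝓢 : SaksSpace 𝕜 X) {V : Set X}
    (hV : V ∈ @nhds X 𝓢.gamma 0) :
    ∃ q : Seminorm 𝕜 X, Continuous[𝓢.gamma, inferInstance] q ∧ ∀ x, q x < 1 → x ∈ V := by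
  have hstep : ∀ A : {A : Set X // A ∈ @nhds X 𝓢.gamma 0},
      ∃ A' : {A : Set X // A ∈ @nhds X 𝓢.gamma 0}, A'.1 + A'.1 ⊆ A.1 := by
    rintro ⟨A, hA⟩
    have := 𝓢.isTopologicalAddGroup_gamma.toContinuousAdd
    obtain ⟨O, hO, h0, h⟩ := @exists_open_nhds_zero_add_subset X 𝓢.gamma _ _ _ hA
    exact ⟨⟨O, @IsOpen.mem_nhds X 𝓢.gamma _ _ hO h0⟩, h⟩
  choose next hnext using hstep
  let Vs : ℕ → {A : Set X // A ∈ @nhds X 𝓢.gamma 0} := fun k => next^[k] ⟨V, hV⟩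
  have hVs : ∀ k, (Vs (k + 1)).1 + (Vs (k + 1)).1 ⊆ (Vs k).1 := fun k => by
    simp only [Vs, Function.iterate_succ_apply']
    exact hnext _
  have hV0 : ∀ k, (0 : X) ∈ (Vs k).1 := fun k => @mem_of_mem_nhds X 𝓢.gamma _ _ (Vs k).2
  -- The radii `k + 1` grow without bound, so every ball is eventually covered; positivity at `k =
  -- 0` makes the first piece a norm neighbourhood, hence absorbent.
  have hW : ∀ k : ℕ, ∃ W ∈ @nhds X 𝓢.tau 0, Balanced 𝕜 W ∧ Convex ℝ W ∧
      W ∩ Metric.closedBall 0 (k + 1 : ℝ) ⊆ (Vs (k + 1)).1 := fun k => by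
    obtain ⟨W, hW, h⟩ := 𝓢.exists_nhds_tau (Vs (k + 1)).2 (k + 1)
    obtain ⟨W', hW', hb, hc, hs⟩ := @exists_balanced_convex_mem_nhds 𝕜 X _ _ _ _ _ 𝓢.tau
      𝓢.continuousSMul 𝓢.topologicalAddGroup 𝓢.locallyConvex W hW
    exact ⟨W', hW', hb, hc, fun x hx => h x (hs hx.1) (by simpa using hx.2)⟩
  choose W hWt hWb hWc hWV using hW
  set K : ℕ → Set X := fun k => W k ∩ Metric.closedBall 0 (k + 1 : ℝ) with hK
  have hK0 : ∀ k, (0 : X) ∈ K k := fun k =>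
    ⟨@mem_of_mem_nhds X 𝓢.tau _ _ (hWt k), by simp; positivity⟩
  have hb : Balanced 𝕜 (finiteSums K) := balanced_finiteSums fun k =>
    (hWb k).inter balanced_closedBall_zero
  have hc : Convex ℝ (finiteSums K) := convex_finiteSums fun k =>
    (hWc k).inter (convex_closedBall 0 _)
  have ha : Absorbent ℝ (finiteSums K) := by
    refine absorbent_nhds_zero (mem_of_superset ?_ (subset_finiteSums hK0 0))
    exact inter_mem (nhds_mono 𝓢.norm_le_tau (hWt 0))
      (Metric.closedBall_mem_nhds _ (by positivity))
  -- The seminorm is the gauge of the finite sums. On a ball, a single piece `K k` with large `k`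
  -- already controls it.
  refine ⟨gaugeSeminorm hb hc ha, 𝓢.continuous_gamma_seminorm _ fun R ε hε => ?_, fun x hx => ?_⟩
  · obtain ⟨k, hk⟩ := exists_nat_ge ((ε / 2)⁻¹ * R)
    have hε2 : 0 < ε / 2 := half_pos hε
    refine ⟨(fun x => (((ε / 2)⁻¹ : ℝ) : 𝕜) • x) ⁻¹' W k, ?_, fun x hx hxR => ?_⟩
    · have hcont : Continuous[𝓢.tau, 𝓢.tau] fun x : X => (((ε / 2)⁻¹ : ℝ) : 𝕜) • x :=
        have := @ContinuousSMul.continuousConstSMul 𝕜 X _ 𝓢.tau _ 𝓢.continuousSMul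
        @continuous_const_smul 𝕜 X 𝓢.tau _ _ _
      refine (@Continuous.tendsto X X 𝓢.tau 𝓢.tau _ hcont 0) ?_
      simpa using hWt k
    · have hxK : (ε / 2)⁻¹ • x ∈ K k := by
        refine ⟨?_, ?_⟩
        · rw [RCLike.real_smul_eq_coe_smul (K := 𝕜)]
          exact hx
        · rw [mem_closedBall_zero_iff, norm_smul, Real.norm_of_nonneg (by positivity)]
          have : (ε / 2)⁻¹ * ‖x‖ ≤ (ε / 2)⁻¹ * R := by gcongr
          linarith
      have hle : gauge (finiteSums K) x ≤ ε / 2 := by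
        refine gauge_le_of_mem hε2.le ?_
        rw [mem_smul_set_iff_inv_smul_mem₀ hε2.ne']
        exact subset_finiteSums hK0 k hxK
      exact hle.trans_lt (half_lt_self hε)
  · have hx' : x ∈ finiteSums K :=
      setOfPred_gauge_lt_one_subset_self hc (subset_finiteSums hK0 0 (hK0 0)) ha hx
    exact finiteSums_subset (V := fun k => (Vs k).1) hV0 hVs hWV hx'

/-- A family on which all continuous seminorms of the mixed topology are bounded is norm-bounded. -/
theorem SaksSpace.exists_norm_le_of_gamma_bounded (𝓢 : SaksSpace 𝕜 X) {ι : Type*} {x : ι → X}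
    (hx : ∀ q : Seminorm 𝕜 X, Continuous[𝓢.gamma, inferInstance] q → ∃ C, ∀ i, q (x i) ≤ C) :
    ∃ R, ∀ i, ‖x i‖ ≤ R := by
  by_contra! hne
  -- The quadratic growth survives division by `k + 1`, so the weighted functionals below are
  -- unbounded along the family.
  choose i hi using fun k : ℕ => hne ((k + 1 : ℝ) ^ 2)
  have hφ : ∀ k : ℕ, ∃ φ : X →ₗ[𝕜] 𝕜, Continuous[𝓢.tau, inferInstance] φ ∧
      (∀ y, ‖φ y‖ ≤ ‖y‖) ∧ (k + 1 : ℝ) ^ 2 < ‖φ (x (i k))‖ := fun k => by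
    obtain ⟨_, ⟨φ, h1, h2, rfl⟩, h3⟩ := (lt_isLUB_iff (𝓢.norming (x (i k)))).1 (hi k)
    exact ⟨φ, h1, h2, h3⟩
  choose φ hφc hφ1 hφx using hφ
  let p : ℕ → Seminorm 𝕜 X := fun k => (normSeminorm 𝕜 𝕜).comp (((k + 1 : ℝ)⁻¹ : 𝕜) • φ k)
  have hp : ∀ k y, p k y = (k + 1 : ℝ)⁻¹ * ‖φ k y‖ := fun k y => by
    simp only [p, Seminorm.comp_apply, LinearMap.smul_apply, coe_normSeminorm, norm_smul, norm_inv,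
      RCLike.norm_ofReal, abs_of_pos (show (0 : ℝ) < k + 1 by positivity)]
  have hple : ∀ k y, p k y ≤ (k + 1 : ℝ)⁻¹ * ‖y‖ := fun k y => by
    rw [hp]; gcongr; exact hφ1 k y
  have hb : BddAbove (range p) := by
    rw [Seminorm.bddAbove_range_iff]
    refine fun y => ⟨‖y‖, ?_⟩
    rintro _ ⟨k, rfl⟩
    refine (hple k y).trans (mul_le_of_le_one_left (norm_nonneg y) ?_)
    exact inv_le_one_of_one_le₀ (by linarith [(Nat.cast_nonneg k : (0 : ℝ) ≤ k)])
  have hcont : Continuous[𝓢.gamma, inferInstance] (⨆ k, p k : Seminorm 𝕜 X) := by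
    refine 𝓢.continuous_gamma_seminorm _ fun R ε hε => ?_
    -- On the ball of radius `R` the terms with `k ≥ N` are at most `ε / 2` by their weight alone;
    -- only finitely many `τ`-continuous functionals remain.
    obtain ⟨N, hN⟩ := exists_nat_gt (R / (ε / 2))
    refine ⟨⋂ k ∈ Finset.range N, {y | ‖φ k y‖ < ε / 2}, ?_, fun y hy hyR => ?_⟩
    · refine (Filter.biInter_finset_mem _).2 fun k _ => ?_
      have h := @Continuous.tendsto X ℝ 𝓢.tau _ _
        (@Continuous.norm _ _ _ 𝓢.tau _ (hφc k)) 0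
      simp only [_root_.map_zero, norm_zero] at h
      exact h.eventually_lt_const (half_pos hε)
    · rw [Seminorm.iSup_apply hb]
      refine (ciSup_le fun k => ?_).trans_lt (half_lt_self hε)
      rcases lt_or_ge k N with hk | hk
      · have hyk : ‖φ k y‖ < ε / 2 := by
          have := mem_iInter₂.1 hy k (Finset.mem_range.2 hk)
          exact this
        rw [hp]
        refine (mul_le_of_le_one_left (norm_nonneg _) ?_).trans hyk.le
        exact inv_le_one_of_one_le₀ (by linarith [(Nat.cast_nonneg k : (0 : ℝ) ≤ k)])
      · refine (hple k y).trans ?_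
        rw [inv_mul_le_iff₀ (by positivity)]
        rw [div_lt_iff₀ (half_pos hε)] at hN
        have hkN : (N : ℝ) ≤ k := by exact_mod_cast hk
        nlinarith
  obtain ⟨C, hC⟩ := hx _ hcont
  obtain ⟨k, hk⟩ := exists_nat_gt C
  have h1 := hC (i k)
  rw [Seminorm.iSup_apply hb] at h1
  have h2 := (le_ciSup ((Seminorm.bddAbove_range_iff.1 hb) (x (i k))) k).trans h1
  rw [hp, inv_mul_le_iff₀ (by positivity)] at h2
  have h3 := hφx k
  nlinarith [(Nat.cast_nonneg k : (0 : ℝ) ≤ k)]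

/-- Sequences converging for the mixed topology are norm-bounded. -/
theorem SaksSpace.exists_norm_le_of_tendsto_gamma (𝓢 : SaksSpace 𝕜 X) {x : ℕ → X} {a : X}
    (hx : Tendsto x atTop (@nhds X 𝓢.gamma a)) : ∃ R, ∀ n, ‖x n‖ ≤ R := by
  refine 𝓢.exists_norm_le_of_gamma_bounded fun q hq => ?_
  have h : Tendsto (fun n => q (x n)) atTop (𝓝 (q a)) :=
    (@Continuous.tendsto X ℝ 𝓢.gamma _ _ hq a).comp hx
  obtain ⟨C, hC⟩ := h.bddAbove_range
  exact ⟨C, fun n => hC ⟨n, rfl⟩⟩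

theorem SaksSpace.tendsto_gamma_iff [IsScalarTower ℝ 𝕜 X] (𝓢 : SaksSpace 𝕜 X) {α : Type*}
    {l : Filter α} {x : α → X} {a : X} :
    Tendsto x l (@nhds X 𝓢.gamma a) ↔ ∀ q : Seminorm 𝕜 X, Continuous[𝓢.gamma, inferInstance] q →
      Tendsto (fun i => q (x i - a)) l (𝓝 0) := by
  have hsub := @tendsto_sub_nhds_zero X _ 𝓢.gamma 𝓢.isTopologicalAddGroup_gamma a
  constructor
  · intro h q hq
    have := ((@Continuous.tendsto X ℝ 𝓢.gamma _ _ hq 0).comp hsub).comp h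
    rwa [_root_.map_zero] at this
  · intro h V hV
    have hadd : Tendsto (fun x => x + a) (@nhds X 𝓢.gamma 0) (@nhds X 𝓢.gamma a) :=
      @tendsto_add_nhds_zero X _ 𝓢.gamma 𝓢.isTopologicalAddGroup_gamma a
    obtain ⟨q, hq, hqV⟩ := 𝓢.exists_seminorm_gamma (hadd hV)
    have hev : ∀ᶠ i in l, x i ∈ V := by
      filter_upwards [(h q hq).eventually_lt_const one_pos] with i hi
      simpa using hqV _ hi
    exact hev

end Mixed

/-! ### Equicontinuity of the semigroup and continuity of the integrand. -/

section Semigroup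

variable {𝕜 X U : Type*} [RCLike 𝕜] [NormedAddCommGroup X] [NormedSpace 𝕜 X] [NormedSpace ℝ X]
  [NormedAddCommGroup U] [NormedSpace 𝕜 U] [NormedSpace ℝ U]

/-- In a C-sequential Saks space, sequentially continuous seminorms are continuous. -/
theorem SaksSpace.CSequential.continuous_seminorm [IsScalarTower ℝ 𝕜 X] {𝓢 : SaksSpace 𝕜 X} (h𝓢 : 𝓢.CSequential)
    (q : Seminorm 𝕜 X) (hq : ∀ (x : ℕ → X) (a : X), Tendsto x atTop (@nhds X 𝓢.gamma a) →
      Tendsto (fun n => q (x n - a)) atTop (𝓝 0)) :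
    Continuous[𝓢.gamma, inferInstance] q := by
  have hopen : IsOpen[𝓢.gamma] (q.ball 0 1) := by
    -- The unit ball of `q` is convex, and the triangle inequality makes it sequentially open.
    refine h𝓢 _ (q.convex_ball 0 1) fun x a ha hx => ?_
    rw [Seminorm.mem_ball_zero] at ha
    filter_upwards [(hq x a hx).eventually_lt_const (sub_pos.2 ha)] with n hn
    rw [Seminorm.mem_ball_zero]
    have := map_add_le_add q (x n - a) a
    rw [sub_add_cancel] at this
    linarith
  have hmem : q.ball 0 1 ∈ @nhds X 𝓢.gamma 0 :=
    @IsOpen.mem_nhds X 𝓢.gamma _ _ hopen (by simp)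
  have := @ContinuousSMul.continuousConstSMul 𝕜 X _ 𝓢.gamma _ 𝓢.continuousSMul_gamma
  exact @Seminorm.continuous 𝕜 X _ _ _ 𝓢.gamma 𝓢.isTopologicalAddGroup_gamma this q 1 hmem

theorem IsLocallyBicontinuousSemigroup.exists_norm_le {𝓢 : SaksSpace 𝕜 X}
    {S : ℝ≥0 → X →L[𝕜] X} (hS : IsLocallyBicontinuousSemigroup 𝓢 S) (T : ℝ) :
    ∃ C, 0 ≤ C ∧ ∀ t : ℝ≥0, (t : ℝ) ≤ T → ‖S t‖ ≤ C := by
  obtain ⟨M, hM, ω, h⟩ := hS.exponentially_bounded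
  refine ⟨M * Real.exp (|ω| * T), by positivity, fun t ht => (h t).trans ?_⟩
  have : ω * t ≤ |ω| * T :=
    (mul_le_mul_of_nonneg_right (le_abs_self ω) t.2).trans
      (mul_le_mul_of_nonneg_left ht (abs_nonneg ω))
  gcongr

theorem SaksSpace.exists_norm_le_seminorm (𝓢 : SaksSpace 𝕜 X) {q : Seminorm 𝕜 X}
    (hq : Continuous[𝓢.gamma, inferInstance] q) : ∃ C, 0 < C ∧ ∀ x, q x ≤ C * ‖x‖ :=
  Seminorm.bound_of_continuous_normedSpace q (𝓢.continuous_seminorm_of_gamma hq)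

/-- A locally bi-continuous semigroup on a C-sequential Saks space is quasi-equicontinuous for
the mixed topology. -/
theorem IsLocallyBicontinuousSemigroup.exists_seminorm_le [IsScalarTower ℝ 𝕜 X]
    {𝓢 : SaksSpace 𝕜 X}
    {S : ℝ≥0 → X →L[𝕜] X} (hS : IsLocallyBicontinuousSemigroup 𝓢 S) (h𝓢 : 𝓢.CSequential) :
    ∃ α : ℝ, ∀ q : Seminorm 𝕜 X, Continuous[𝓢.gamma, inferInstance] q →
      ∃ p : Seminorm 𝕜 X, Continuous[𝓢.gamma, inferInstance] p ∧
        ∀ (t : ℝ≥0) (x : X), Real.exp (-α * t) * q (S t x) ≤ p x := by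
  obtain ⟨M, hM, ω, hω⟩ := hS.exponentially_bounded
  have hM0 : 0 < M := one_pos.trans_le hM
  -- The extra `1` leaves a factor `e^{-t}`, which makes the tail of the supremum uniformly small on
  -- bounded sets.
  refine ⟨ω + 1, fun q hq => ?_⟩
  obtain ⟨C, hC0, hC⟩ := 𝓢.exists_norm_le_seminorm hq
  let F : ℝ≥0 → Seminorm 𝕜 X := fun t =>
    q.comp (((Real.exp (-(ω + 1) * t) : ℝ) : 𝕜) • (S t).toLinearMap)
  have hF : ∀ t x, F t x = Real.exp (-(ω + 1) * t) * q (S t x) := fun t x => by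
    simp only [F, Seminorm.comp_apply, LinearMap.smul_apply, map_smul_eq_mul, RCLike.norm_ofReal,
      abs_of_pos (Real.exp_pos _), ContinuousLinearMap.coe_coe]
  have hFle : ∀ t x, F t x ≤ C * M * ‖x‖ * Real.exp (-t) := fun t x => by
    have h1 : q (S t x) ≤ C * (M * Real.exp (ω * t) * ‖x‖) :=
      (hC _).trans (mul_le_mul_of_nonneg_left (((S t).le_opNorm x).trans
        (mul_le_mul_of_nonneg_right (hω t) (norm_nonneg x))) hC0.le)
    rw [hF]
    calc _ ≤ Real.exp (-(ω + 1) * t) * (C * (M * Real.exp (ω * t) * ‖x‖)) := by gcongr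
      _ = C * M * ‖x‖ * (Real.exp (-(ω + 1) * t) * Real.exp (ω * t)) := by ring
      _ = C * M * ‖x‖ * Real.exp (-t) := by rw [← Real.exp_add]; ring_nf
  have hb : BddAbove (range F) := by
    rw [Seminorm.bddAbove_range_iff]
    refine fun x => ⟨C * M * ‖x‖, ?_⟩
    rintro _ ⟨t, rfl⟩
    exact (hFle t x).trans (mul_le_of_le_one_right (by positivity)
      (Real.exp_le_one_iff.2 (neg_nonpos.2 t.2)))
  refine ⟨⨆ t, F t, h𝓢.continuous_seminorm _ fun x a hx => ?_, fun t x => ?_⟩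
  swap
  · rw [Seminorm.iSup_apply hb, ← hF]
    exact le_ciSup ((Seminorm.bddAbove_range_iff.1 hb) x) t
  -- Bi-equicontinuity applies only to norm-bounded sequences; `γ`-convergence supplies the bound.
  obtain ⟨R₀, hR₀⟩ := 𝓢.exists_norm_le_of_tendsto_gamma hx
  set R := R₀ + ‖a‖ with hRdef
  have hR : ∀ n, ‖x n - a‖ ≤ R := fun n => (norm_sub_le _ _).trans (add_le_add_left (hR₀ n) _)
  have hR0 : 0 ≤ R := (norm_nonneg _).trans (hR 0)
  have hτ : Tendsto x atTop (@nhds X 𝓢.tau a) := hx.mono_right (nhds_mono 𝓢.gamma_le_tau)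
  have hbdd : BddAbove (range fun n => ‖x n‖) := ⟨R₀, by rintro _ ⟨n, rfl⟩; exact hR₀ n⟩
  rw [Metric.tendsto_atTop']
  intro ε hε
  have hlim : Tendsto (fun t : ℝ => C * M * R * Real.exp (-t)) atTop (𝓝 0) := by
    simpa using Real.tendsto_exp_neg_atTop_nhds_zero.const_mul (C * M * R)
  obtain ⟨t₀, ht₀, ht₀0⟩ :=
    ((hlim.eventually_lt_const (half_pos hε)).and (eventually_ge_atTop 0)).exists
  lift t₀ to ℝ≥0 using ht₀0
  obtain ⟨D, hD0, hD⟩ := hS.exists_norm_le t₀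
  -- The factor in `δ` absorbs the largest possible weight `e^{-(ω+1)t}` on `[0,t₀]`.
  set δ : ℝ := ε / 2 * Real.exp (-(|ω + 1| * t₀)) with hδ
  have hδ0 : 0 < δ := by positivity
  obtain ⟨W, hW, hWq⟩ := 𝓢.exists_nhds_tau (𝓢.seminorm_lt_mem_nhds hq hδ0) (D * R)
  obtain ⟨N, hN⟩ := eventually_atTop.1 (hS.locally_bi_equicontinuous x a hbdd hτ t₀ W hW)
  refine ⟨N, fun n hn => ?_⟩
  rw [Real.dist_eq, sub_zero, abs_of_nonneg (apply_nonneg _ _), Seminorm.iSup_apply hb]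
  refine (ciSup_le fun t => ?_).trans_lt (half_lt_self hε)
  rcases le_total t t₀ with ht | ht
  · have hnorm : ‖S t (x n - a)‖ ≤ D * R :=
      ((S t).le_opNorm _).trans (mul_le_mul (hD t ht) (hR n) (norm_nonneg _) hD0)
    have hlt : q (S t (x n - a)) < δ := hWq _ (hN n hn.le t ht) hnorm
    have hexp : -(ω + 1) * t ≤ |ω + 1| * t₀ :=
      mul_le_mul (neg_le_abs _) ht t.2 (abs_nonneg _)
    rw [hF]
    calc _ ≤ Real.exp (|ω + 1| * t₀) * δ := by gcongr
      _ = ε / 2 * (Real.exp (|ω + 1| * t₀) * Real.exp (-(|ω + 1| * t₀))) := by rw [hδ]; ring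
      _ = ε / 2 := by rw [← Real.exp_add]; simp
  · refine (hFle t _).trans (le_trans ?_ ht₀.le)
    have : (t₀ : ℝ) ≤ t := ht
    gcongr
    exact hR n

/-- A bounded operator maps balls into balls, where `γ` and `τ` agree; so continuity on bounded sets
is what the seminorm test needs. -/
theorem ContinuousOnBounded.continuous_comp {𝓢U : SaksSpace 𝕜 U} {𝓢X : SaksSpace 𝕜 X}
    {B : U →L[𝕜] X} (hB : ContinuousOnBounded 𝓢U 𝓢X B) {q : Seminorm 𝕜 X}
    (hq : Continuous[𝓢X.gamma, inferInstance] q) :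
    Continuous[𝓢U.gamma, inferInstance] (q.comp B.toLinearMap) := by
  refine 𝓢U.continuous_gamma_seminorm _ fun R ε hε => ?_
  obtain ⟨W, hW, hWq⟩ := 𝓢X.exists_nhds_tau (𝓢X.seminorm_lt_mem_nhds hq hε) (‖B‖ * R)
  have h0 : (0 : U) ∈ Metric.closedBall (0 : U) |R| := by simp
  have h := hB _ Metric.isBounded_closedBall 0 h0
  unfold ContinuousWithinAt at h
  rw [_root_.map_zero] at h
  obtain ⟨O, hO, hOW⟩ := (@mem_nhdsWithin_iff_exists_mem_nhds_inter U 𝓢U.tau _ _ _).1 (h hW)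
  refine ⟨O, hO, fun u hu huR => hWq _ (hOW ⟨hu, ?_⟩) ?_⟩
  · simpa using huR.trans (le_abs_self R)
  · exact (B.le_opNorm u).trans (mul_le_mul_of_nonneg_left huR (norm_nonneg B))

theorem quasiEquicontinuous_comp [IsScalarTower ℝ 𝕜 X] {𝓢U : SaksSpace 𝕜 U} {𝓢X : SaksSpace 𝕜 X}
    {S : ℝ≥0 → X →L[𝕜] X} (hS : IsLocallyBicontinuousSemigroup 𝓢X S) (hX : 𝓢X.CSequential)
    {B : U →L[𝕜] X} (hB : ContinuousOnBounded 𝓢U 𝓢X B) :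
    QuasiEquicontinuous 𝓢U.gamma 𝓢X.gamma
      (fun t => ((S t).comp B : U →L[𝕜] X).toLinearMap) := by
  obtain ⟨α, h⟩ := hS.exists_seminorm_le hX
  refine ⟨α, fun V hV => ?_⟩
  obtain ⟨q, hq, hqV⟩ := 𝓢X.exists_seminorm_gamma hV
  obtain ⟨p, hp, hpq⟩ := h q hq
  refine ⟨_, 𝓢U.seminorm_lt_mem_nhds (hB.continuous_comp hp) one_pos, fun t u hu => hqV _ ?_⟩
  rw [map_smul_eq_mul, RCLike.norm_ofReal, abs_of_pos (Real.exp_pos _)]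
  exact (hpq t (B u)).trans_lt hu

theorem Ctb.norm_eval_le (𝓢 : SaksSpace 𝕜 U) {T : ℝ} (u : Ctb 𝓢 T) (t : Icc (0 : ℝ) T) :
    ‖Ctb.eval 𝓢 T t u‖ ≤ ‖u‖ :=
  lp.norm_apply_le_norm (E := fun _ : Icc (0 : ℝ) T => U) ENNReal.top_ne_zero _ _

theorem Ctb.tendsto_eval (𝓢 : SaksSpace 𝕜 U) {T : ℝ} (u : Ctb 𝓢 T) (t₀ : Icc (0 : ℝ) T) :
    Tendsto (fun t => Ctb.eval 𝓢 T t u) (𝓝 t₀) (@nhds U 𝓢.gamma (Ctb.eval 𝓢 T t₀ u)) :=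
  𝓢.tendsto_gamma (Ctb.norm_eval_le 𝓢 u) (@Continuous.tendsto _ _ _ 𝓢.tau _ u.2 t₀)

theorem norm_inputIntegrand_le {𝕜 X U : Type*} [RCLike 𝕜] [NormedAddCommGroup X]
    [NormedSpace 𝕜 X] [NormedAddCommGroup U] [NormedSpace 𝕜 U] [NormedSpace ℝ U]
    {𝓢U : SaksSpace 𝕜 U} {S : ℝ≥0 → X →L[𝕜] X} {B : U →L[𝕜] X}
    {T C : ℝ} (hC : ∀ t : ℝ≥0, (t : ℝ) ≤ T → ‖S t‖ ≤ C) (u : Ctb 𝓢U T) (t : Icc (0 : ℝ) T) :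
    ‖inputIntegrand 𝓢U S B T u t‖ ≤ C * ‖B‖ * ‖u‖ := by
  have h1 := hC ⟨T - t, sub_nonneg.2 t.2.2⟩ (sub_le_self T t.2.1)
  have hC0 := (norm_nonneg _).trans h1
  refine ((S _).le_opNorm _).trans ?_
  rw [mul_assoc]
  refine mul_le_mul h1 ((B.le_opNorm _).trans ?_) (norm_nonneg _) hC0
  gcongr
  exact Ctb.norm_eval_le 𝓢U u t

theorem seminorm_le_exp_mul {𝕜 X : Type*} [RCLike 𝕜] [NormedAddCommGroup X] [NormedSpace 𝕜 X]
    {S : ℝ≥0 → X →L[𝕜] X} {α : ℝ} {p q : Seminorm 𝕜 X}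
    (h : ∀ (t : ℝ≥0) (x : X), Real.exp (-α * t) * q (S t x) ≤ p x) {T : ℝ} (t : ℝ≥0)
    (ht : (t : ℝ) ≤ T) (x : X) : q (S t x) ≤ Real.exp (|α| * T) * p x := by
  have h1 : q (S t x) = Real.exp (α * t) * (Real.exp (-α * t) * q (S t x)) := by
    rw [← mul_assoc, ← Real.exp_add]; simp
  have h2 : α * t ≤ |α| * T := mul_le_mul (le_abs_self _) ht t.2 (abs_nonneg _)
  rw [h1]
  refine mul_le_mul (Real.exp_le_exp.2 h2) (h t x) ?_ (Real.exp_pos _).le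
  have := apply_nonneg q (S t x)
  positivity

theorem tendsto_inputIntegrand [IsScalarTower ℝ 𝕜 X] [IsScalarTower ℝ 𝕜 U]
    {𝓢U : SaksSpace 𝕜 U} {𝓢X : SaksSpace 𝕜 X}
    {S : ℝ≥0 → X →L[𝕜] X} (hS : IsLocallyBicontinuousSemigroup 𝓢X S) (hX : 𝓢X.CSequential)
    {B : U →L[𝕜] X} (hB : ContinuousOnBounded 𝓢U 𝓢X B) {T : ℝ} (u : Ctb 𝓢U T)
    (t₀ : Icc (0 : ℝ) T) :
    Tendsto (inputIntegrand 𝓢U S B T u) (𝓝 t₀)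
      (@nhds X 𝓢X.gamma (inputIntegrand 𝓢U S B T u t₀)) := by
  obtain ⟨α, h⟩ := hS.exists_seminorm_le hX
  obtain ⟨C, hC0, hC⟩ := hS.exists_norm_le T
  refine 𝓢X.tendsto_gamma_iff.2 fun q hq => ?_
  obtain ⟨p, hp, hpq⟩ := h q hq
  let r : Icc (0 : ℝ) T → ℝ≥0 := fun t => ⟨T - t, sub_nonneg.2 t.2.2⟩
  have hrT : ∀ t, (r t : ℝ) ≤ T := fun t => sub_le_self T t.2.1
  have hr : Continuous r := by
    refine Continuous.subtype_mk ?_ _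
    fun_prop
  set y := B (Ctb.eval 𝓢U T t₀ u) with hy
  have h1 : Tendsto (fun t => q (S (r t) y - S (r t₀) y)) (𝓝 t₀) (𝓝 0) := by
    have hτ : Tendsto (fun t => S (r t) y) (𝓝 t₀) (@nhds X 𝓢X.tau (S (r t₀) y)) :=
      (@Continuous.tendsto _ _ _ 𝓢X.tau _ (hS.strongly_continuous y) (r t₀)).comp (hr.tendsto t₀)
    refine 𝓢X.tendsto_gamma_iff.1 (𝓢X.tendsto_gamma (R := C * ‖y‖) (fun t => ?_) hτ) q hq
    exact ((S _).le_opNorm _).trans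
      (mul_le_mul_of_nonneg_right (hC _ (hrT t)) (norm_nonneg _))
  have h2 : Tendsto (fun t => Real.exp (|α| * T) *
      (p.comp B.toLinearMap) (Ctb.eval 𝓢U T t u - Ctb.eval 𝓢U T t₀ u)) (𝓝 t₀) (𝓝 0) := by
    have := 𝓢U.tendsto_gamma_iff.1 (Ctb.tendsto_eval 𝓢U u t₀) _ (hB.continuous_comp hp)
    simpa using this.const_mul (Real.exp (|α| * T))
  have h3 := h2.add h1
  rw [add_zero] at h3
  refine squeeze_zero (fun t => apply_nonneg q _) (fun t => ?_) h3
  -- Equicontinuity controls the first summand uniformly in the moving semigroup time; strong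
  -- continuity at the fixed vector `y` controls the second.
  have heq : inputIntegrand 𝓢U S B T u t - inputIntegrand 𝓢U S B T u t₀ =
      S (r t) (B (Ctb.eval 𝓢U T t u - Ctb.eval 𝓢U T t₀ u)) + (S (r t) y - S (r t₀) y) := by
    simp [inputIntegrand, r, hy]
  rw [heq]
  refine (map_add_le_add q _ _).trans ?_
  exact add_le_add_left (seminorm_le_exp_mul hpq (r t) (hrT t) _) _

/-- In a C-sequential Saks space the elements of `X°` are continuous for the mixed topology. -/
theorem SaksSpace.CSequential.continuous_of_mem_circDual [IsScalarTower ℝ 𝕜 X]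
    {𝓢 : SaksSpace 𝕜 X}
    (h𝓢 : 𝓢.CSequential) {φ : X →L[𝕜] 𝕜} (hφ : φ ∈ 𝓢.circDual) :
    Continuous[𝓢.gamma, inferInstance] φ := by
  -- The C-sequential criterion is available for seminorms, so it is applied to the modulus of `φ`.
  have hq : Continuous[𝓢.gamma, inferInstance] ((normSeminorm 𝕜 𝕜).comp φ.toLinearMap) := by
    refine h𝓢.continuous_seminorm _ fun x a hx => ?_
    obtain ⟨R, hR⟩ := 𝓢.exists_norm_le_of_tendsto_gamma hx
    have h := hφ x a ⟨R, by rintro _ ⟨n, rfl⟩; exact hR n⟩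
      (hx.mono_right (nhds_mono 𝓢.gamma_le_tau))
    have := (h.sub_const (φ a)).norm
    simpa using this
  rw [@continuous_iff_continuousAt X 𝕜 𝓢.gamma]
  intro a
  have h := 𝓢.tendsto_gamma_iff.1 (tendsto_id (x := @nhds X 𝓢.gamma a)) _ hq
  refine tendsto_iff_norm_sub_tendsto_zero.2 ?_
  simpa using h

end Semigroup

/-! ### Pettis integrals in Saks spaces. -/

section Pettis

theorem continuous_seminorm_sub {𝕜 X Ω : Type*} [RCLike 𝕜] [AddCommGroup X] [Module 𝕜 X]
    [TopologicalSpace X] [IsTopologicalAddGroup X] [TopologicalSpace Ω] {q : Seminorm 𝕜 X}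
    (hq : Continuous q) {f : Ω → X} (hf : Continuous f) :
    Continuous fun p : Ω × Ω => q (f p.1 - f p.2) :=
  hq.comp ((hf.comp continuous_fst).sub (hf.comp continuous_snd))

theorem HasPettisIntegral.add {𝕜 X Ω : Type*} [RCLike 𝕜] [AddCommGroup X] [Module 𝕜 X]
    [MeasurableSpace Ω] {t : TopologicalSpace X} {μ : Measure Ω} {f g : Ω → X} {x y : X}
    (hf : HasPettisIntegral 𝕜 t μ f x) (hg : HasPettisIntegral 𝕜 t μ g y) :
    HasPettisIntegral 𝕜 t μ (fun ω => f ω + g ω) (x + y) := fun φ hφ => by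
  simp only [map_add]
  exact ⟨(hf φ hφ).1.add (hg φ hφ).1, by
    rw [integral_add (hf φ hφ).1 (hg φ hφ).1, (hf φ hφ).2, (hg φ hφ).2]⟩

theorem HasPettisIntegral.smul {𝕜 X Ω : Type*} [RCLike 𝕜] [AddCommGroup X] [Module 𝕜 X]
    [MeasurableSpace Ω] {t : TopologicalSpace X} {μ : Measure Ω} {f : Ω → X} {x : X} (c : 𝕜)
    (hf : HasPettisIntegral 𝕜 t μ f x) :
    HasPettisIntegral 𝕜 t μ (fun ω => c • f ω) (c • x) := fun φ hφ => by
  simp only [map_smul]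
  exact ⟨(hf φ hφ).1.smul c, by rw [integral_smul, (hf φ hφ).2]⟩

theorem HasPettisIntegral.mono {𝕜 X Ω : Type*} [RCLike 𝕜] [AddCommGroup X] [Module 𝕜 X]
    [MeasurableSpace Ω] {s t : TopologicalSpace X} (hst : s ≤ t) {μ : Measure Ω} {f : Ω → X}
    {x : X} (hf : HasPettisIntegral 𝕜 s μ f x) : HasPettisIntegral 𝕜 t μ f x :=
  fun φ hφ => hf φ (continuous_le_dom hst hφ)

variable {𝕜 X Ω : Type*} [RCLike 𝕜] [NormedAddCommGroup X] [NormedSpace 𝕜 X] [NormedSpace ℝ X]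
  [MeasurableSpace Ω]

theorem SaksSpace.eq_zero_of_forall (𝓢 : SaksSpace 𝕜 X) {x : X}
    (h : ∀ φ : X →ₗ[𝕜] 𝕜, Continuous[𝓢.tau, inferInstance] φ → φ x = 0) : x = 0 := by
  refine norm_le_zero_iff.1 ((𝓢.norming x).2 ?_)
  rintro _ ⟨φ, hφ, -, rfl⟩
  simp [h φ hφ]

theorem SaksSpace.hasPettisIntegral_unique (𝓢 : SaksSpace 𝕜 X) {μ : Measure Ω} {f : Ω → X}
    {x y : X} (hx : HasPettisIntegral 𝕜 𝓢.tau μ f x) (hy : HasPettisIntegral 𝕜 𝓢.tau μ f y) :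
    x = y := by
  refine sub_eq_zero.1 (𝓢.eq_zero_of_forall fun φ hφ => ?_)
  rw [map_sub, ← (hx φ hφ).2, ← (hy φ hφ).2, sub_self]

theorem SaksSpace.pettisIntegral_eq (𝓢 : SaksSpace 𝕜 X) {μ : Measure Ω} {f : Ω → X}
    {x : X} (hx : HasPettisIntegral 𝕜 𝓢.tau μ f x) : pettisIntegral 𝕜 𝓢.tau μ f = x := by
  have h : ∃ x, HasPettisIntegral 𝕜 𝓢.tau μ f x := ⟨x, hx⟩
  rw [pettisIntegral, dif_pos h]
  exact 𝓢.hasPettisIntegral_unique h.choose_spec hx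

theorem SaksSpace.norm_le_of_hasPettisIntegral (𝓢 : SaksSpace 𝕜 X) {μ : Measure Ω}
    [IsFiniteMeasure μ] {f : Ω → X} {x : X} (hx : HasPettisIntegral 𝕜 𝓢.tau μ f x) {C : ℝ}
    (hC : ∀ ω, ‖f ω‖ ≤ C) : ‖x‖ ≤ C * μ.real univ := by
  refine (𝓢.norming x).2 ?_
  rintro _ ⟨φ, hφ, hφ1, rfl⟩
  rw [← (hx φ hφ).2]
  exact norm_integral_le_of_norm_le_const (Eventually.of_forall fun ω => (hφ1 _).trans (hC ω))

/-- Jensen's inequality for the convex function `q`, after normalising the measure; the zero measure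
has no such normalisation and is treated apart. -/
theorem seminorm_integral_le [IsScalarTower ℝ 𝕜 X] [CompleteSpace X] {μ : Measure Ω}
    [IsFiniteMeasure μ] {q : Seminorm 𝕜 X} (hq : Continuous q) {f : Ω → X} (hf : Integrable f μ) :
    Integrable (fun ω => q (f ω)) μ ∧ q (∫ ω, f ω ∂μ) ≤ ∫ ω, q (f ω) ∂μ := by
  obtain ⟨C, hC0, hC⟩ := Seminorm.bound_of_continuous_normedSpace q hq
  have hint : Integrable (fun ω => q (f ω)) μ :=
    (hf.norm.const_mul C).mono' (hq.comp_aestronglyMeasurable hf.aestronglyMeasurable)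
      (Eventually.of_forall fun ω => by
        rw [Real.norm_of_nonneg (apply_nonneg _ _)]; exact hC _)
  refine ⟨hint, ?_⟩
  rcases eq_zero_or_neZero μ with rfl | hμ
  · simp
  have h := ConvexOn.map_average_le (s := univ) (μ := μ) (f := f) q.convexOn hq.continuousOn
    isClosed_univ (by simp) hf hint
  have hpos : 0 < μ.real univ := measureReal_univ_pos
  rw [average_eq, average_eq, RCLike.real_smul_eq_coe_smul (K := 𝕜), map_smul_eq_mul,
    RCLike.norm_ofReal, abs_of_pos (inv_pos.2 hpos), smul_eq_mul] at h
  exact le_of_mul_le_mul_left h (inv_pos.2 hpos)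

/-- Continuous functions from a compact metric space into a sequentially complete Saks space are
Pettis integrable for the mixed topology. -/
theorem SaksSpace.SequentiallyComplete.exists_hasPettisIntegral [IsScalarTower ℝ 𝕜 X]
    {𝓢 : SaksSpace 𝕜 X} (h𝓢 : 𝓢.SequentiallyComplete) [MetricSpace Ω] [CompactSpace Ω]
    [BorelSpace Ω] [Nonempty Ω] (μ : Measure Ω) [IsFiniteMeasure μ] {f : Ω → X}
    (hf : Continuous[inferInstance, 𝓢.gamma] f) {C : ℝ} (hC : ∀ ω, ‖f ω‖ ≤ C) :
    ∃ x, HasPettisIntegral 𝕜 𝓢.gamma μ f x ∧ ∀ q : Seminorm 𝕜 X,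
      Continuous[𝓢.gamma, inferInstance] q → q x ≤ ∫ ω, q (f ω) ∂μ := by
  have := 𝓢.complete
  obtain ⟨ω₀⟩ := ‹Nonempty Ω›
  -- Approximating the identity of `Ω` rather than `f` makes each `f ∘ g n` simple, hence Bochner
  -- integrable, although `f` need not be norm-measurable.
  let g : ℕ → SimpleFunc Ω Ω := fun n =>
    SimpleFunc.approxOn id measurable_id univ ω₀ (mem_univ _) n
  have hg : ∀ ω, Tendsto (fun n => g n ω) atTop (𝓝 ω) := fun ω =>
    SimpleFunc.tendsto_approxOn measurable_id (mem_univ ω₀) (by simp)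
  have hint : ∀ n, Integrable (fun ω => f (g n ω)) μ := fun n =>
    SimpleFunc.integrable_of_isFiniteMeasure ((g n).map f)
  let R : ℕ → X := fun n => ∫ ω, f (g n ω) ∂μ
  have hD : ∀ q : Seminorm 𝕜 X, Continuous[𝓢.gamma, inferInstance] q →
      Continuous fun p : Ω × Ω => q (f p.1 - f p.2) := fun q hq =>
    @continuous_seminorm_sub 𝕜 X Ω _ _ _ 𝓢.gamma 𝓢.isTopologicalAddGroup_gamma _ q hq f hf
  choose! D hD0 hDle using fun (q : Seminorm 𝕜 X) (hq : Continuous[𝓢.gamma, inferInstance] q) =>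
    𝓢.exists_norm_le_seminorm hq
  have hDint : ∀ q : Seminorm 𝕜 X, Continuous[𝓢.gamma, inferInstance] q → ∀ n,
      Integrable (fun ω => q (f (g n ω) - f ω)) μ ∧
      ∀ ω, ‖q (f (g n ω) - f ω)‖ ≤ D q * (C + C) := by
    intro q hq n
    have hb : ∀ ω, ‖q (f (g n ω) - f ω)‖ ≤ D q * (C + C) := by
      intro ω
      rw [Real.norm_of_nonneg (apply_nonneg _ _)]
      exact (hDle q hq _).trans (mul_le_mul_of_nonneg_left
        ((norm_sub_le _ _).trans (add_le_add (hC _) (hC _))) (hD0 q hq).le)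
    have hm : Measurable fun ω => q (f (g n ω) - f ω) :=
      (hD q hq).measurable.comp ((g n).measurable.prodMk measurable_id)
    exact ⟨Integrable.of_bound hm.aestronglyMeasurable _ (Eventually.of_forall hb), hb⟩
  -- Dominated convergence for scalar functions: `γ`-continuity of `f` gives the pointwise limit,
  -- the norm bound the majorant.
  have ha : ∀ q : Seminorm 𝕜 X, Continuous[𝓢.gamma, inferInstance] q →
      Tendsto (fun n => ∫ ω, q (f (g n ω) - f ω) ∂μ) atTop (𝓝 0) := by
    intro q hq
    have h := tendsto_integral_of_dominated_convergence (μ := μ) (f := fun _ => (0 : ℝ))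
      (fun _ => D q * (C + C))
      (fun n => (hDint q hq n).1.aestronglyMeasurable) (integrable_const _)
      (fun n => Eventually.of_forall (hDint q hq n).2) (Eventually.of_forall fun ω => ?_)
    · simpa using h
    · have := ((hD q hq).tendsto (ω, ω)).comp ((hg ω).prodMk_nhds (tendsto_const_nhds (x := ω)))
      simpa [Function.comp_def] using this
  have hcauchy : ∀ V ∈ @nhds X 𝓢.gamma 0, ∃ N : ℕ, ∀ m ≥ N, ∀ n ≥ N, R m - R n ∈ V := by
    intro V hV
    obtain ⟨q, hq, hqV⟩ := 𝓢.exists_seminorm_gamma hV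
    obtain ⟨N, hN⟩ := eventually_atTop.1 ((ha q hq).eventually_lt_const (half_pos one_pos))
    refine ⟨N, fun m hm n hn => hqV _ ?_⟩
    have h1 := seminorm_integral_le (𝓢.continuous_seminorm_of_gamma hq) ((hint m).sub (hint n))
    simp only [Pi.sub_apply] at h1
    rw [integral_sub (hint m) (hint n)] at h1
    have h2 : ∫ ω, q (f (g m ω) - f (g n ω)) ∂μ ≤
        ∫ ω, (q (f (g m ω) - f ω) + q (f (g n ω) - f ω)) ∂μ := by
      refine integral_mono h1.1 ((hDint q hq m).1.add (hDint q hq n).1) fun ω => ?_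
      have := map_sub_le_add q (f (g m ω) - f ω) (f (g n ω) - f ω)
      rwa [sub_sub_sub_cancel_right] at this
    rw [integral_add (hDint q hq m).1 (hDint q hq n).1] at h2
    linarith [hN m hm, hN n hn, h1.2]
  obtain ⟨x, hx⟩ := h𝓢 R hcauchy
  refine ⟨x, fun φ hφ => ?_, fun q hq => ?_⟩
  · let Φ : X →L[𝕜] 𝕜 := ⟨φ, continuous_le_dom 𝓢.norm_le_gamma hφ⟩
    have hφf : Continuous fun ω => φ (f ω) := @Continuous.comp _ _ _ _ 𝓢.gamma _ _ _ hφ hf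
    have hb : ∀ ω, ‖φ (f ω)‖ ≤ ‖Φ‖ * C := fun ω =>
      (Φ.le_opNorm (f ω)).trans (mul_le_mul_of_nonneg_left (hC ω) (norm_nonneg _))
    refine ⟨Integrable.of_bound hφf.aestronglyMeasurable _ (Eventually.of_forall hb), ?_⟩
    have h1 : Tendsto (fun n => ∫ ω, φ (f (g n ω)) ∂μ) atTop (𝓝 (∫ ω, φ (f ω) ∂μ)) :=
      tendsto_integral_of_dominated_convergence (fun _ => ‖Φ‖ * C)
        (fun n => (hφf.measurable.comp (g n).measurable).aestronglyMeasurable)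
        (integrable_const _) (fun n => Eventually.of_forall fun ω => hb _)
        (Eventually.of_forall fun ω => (hφf.tendsto ω).comp (hg ω))
    have h2 : Tendsto (fun n => φ (R n)) atTop (𝓝 (φ x)) :=
      (@Continuous.tendsto X 𝕜 𝓢.gamma _ _ hφ x).comp hx
    have h3 : ∀ n, ∫ ω, φ (f (g n ω)) ∂μ = φ (R n) := fun n => Φ.integral_comp_comm (hint n)
    simp only [h3] at h1
    exact tendsto_nhds_unique h1 h2
  · have hqf : Continuous fun ω => q (f ω) := @Continuous.comp _ _ _ _ 𝓢.gamma _ _ _ hq hf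
    have hqint : Integrable (fun ω => q (f ω)) μ :=
      Integrable.of_bound hqf.aestronglyMeasurable (D q * C) (Eventually.of_forall fun ω => by
        rw [Real.norm_of_nonneg (apply_nonneg _ _)]
        exact (hDle q hq _).trans (mul_le_mul_of_nonneg_left (hC ω) (hD0 q hq).le))
    have h1 : Tendsto (fun n => q (R n)) atTop (𝓝 (q x)) :=
      (@Continuous.tendsto X ℝ 𝓢.gamma _ _ hq x).comp hx
    have h2 := (ha q hq).add_const (∫ ω, q (f ω) ∂μ)
    rw [zero_add] at h2
    refine le_of_tendsto_of_tendsto' h1 h2 fun n => ?_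
    have h3 := seminorm_integral_le (𝓢.continuous_seminorm_of_gamma hq) (hint n)
    rw [← integral_add (hDint q hq n).1 hqint]
    refine h3.2.trans (integral_mono h3.1 ((hDint q hq n).1.add hqint) fun ω => ?_)
    have := map_add_le_add q (f (g n ω) - f ω) (f ω)
    rwa [sub_add_cancel] at this

theorem isFiniteMeasure_lebesgueIcc (T : ℝ) : IsFiniteMeasure (lebesgueIcc T) := by
  refine ⟨?_⟩
  rw [lebesgueIcc, (MeasurableEmbedding.subtype_coe measurableSet_Icc).comap_apply]
  rw [image_univ, Subtype.range_coe]
  exact isCompact_Icc.measure_lt_top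

end Pettis

/-! ### The input map and its seminorm estimates. -/

section InputMap

variable {𝕜 X U : Type*} [RCLike 𝕜] [NormedAddCommGroup X] [NormedSpace 𝕜 X] [NormedSpace ℝ X]
  [IsScalarTower ℝ 𝕜 X] [NormedAddCommGroup U] [NormedSpace 𝕜 U] [NormedSpace ℝ U]
  [IsScalarTower ℝ 𝕜 U]

/-- The constructed `γ`-Pettis integral is also a `τ`-Pettis integral, and uniqueness identifies it
with the chosen value `inputMap`, which thereby inherits the seminorm estimate. -/
theorem inputMap_spec {𝓢X : SaksSpace 𝕜 X} (hX : 𝓢X.SequentiallyComplete)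
    (hXC : 𝓢X.CSequential) {𝓢U : SaksSpace 𝕜 U} {S : ℝ≥0 → X →L[𝕜] X}
    (hS : IsLocallyBicontinuousSemigroup 𝓢X S) {B : U →L[𝕜] X}
    (hB : ContinuousOnBounded 𝓢U 𝓢X B) {T : ℝ} (hT : 0 < T) (u : Ctb 𝓢U T) :
    HasPettisIntegral 𝕜 𝓢X.gamma (lebesgueIcc T) (inputIntegrand 𝓢U S B T u)
      (inputMap 𝓢U 𝓢X S B T u) ∧
    ∀ q : Seminorm 𝕜 X, Continuous[𝓢X.gamma, inferInstance] q →
      q (inputMap 𝓢U 𝓢X S B T u) ≤ ∫ t, q (inputIntegrand 𝓢U S B T u t) ∂lebesgueIcc T := by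
  have := isFiniteMeasure_lebesgueIcc T
  have : Nonempty (Icc (0 : ℝ) T) := ⟨⟨0, le_rfl, hT.le⟩⟩
  obtain ⟨C, -, hC⟩ := hS.exists_norm_le T
  obtain ⟨x, hx, hq⟩ := hX.exists_hasPettisIntegral (lebesgueIcc T)
    ((@continuous_iff_continuousAt _ _ _ 𝓢X.gamma _).2 (tendsto_inputIntegrand hS hXC hB u))
    (norm_inputIntegrand_le hC u)
  rw [inputMap, 𝓢X.pettisIntegral_eq (hx.mono 𝓢X.gamma_le_tau)]
  exact ⟨hx, hq⟩

theorem inputMap_seminorm_le {𝓢X : SaksSpace 𝕜 X} (hX : 𝓢X.SequentiallyComplete)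
    (hXC : 𝓢X.CSequential) {𝓢U : SaksSpace 𝕜 U} {S : ℝ≥0 → X →L[𝕜] X}
    (hS : IsLocallyBicontinuousSemigroup 𝓢X S) {B : U →L[𝕜] X}
    (hB : ContinuousOnBounded 𝓢U 𝓢X B) {T : ℝ} (hT : 0 < T) {q : Seminorm 𝕜 X}
    (hq : Continuous[𝓢X.gamma, inferInstance] q) :
    ∃ (p : Seminorm 𝕜 U) (C : ℝ), Continuous[𝓢U.gamma, inferInstance] p ∧
      ∀ u, q (inputMap 𝓢U 𝓢X S B T u) ≤ C * Ctb.supSeminorm 𝓢U T p u := by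
  have := isFiniteMeasure_lebesgueIcc T
  obtain ⟨α, h⟩ := hS.exists_seminorm_le hXC
  obtain ⟨p, hp, hpq⟩ := h q hq
  have hpB := hB.continuous_comp hp
  obtain ⟨D, hD0, hD⟩ := 𝓢U.exists_norm_le_seminorm hpB
  refine ⟨_, Real.exp (|α| * T) * (lebesgueIcc T).real univ, hpB, fun u => ?_⟩
  have hle : ∀ t, q (inputIntegrand 𝓢U S B T u t) ≤
      Real.exp (|α| * T) * Ctb.supSeminorm 𝓢U T (p.comp B.toLinearMap) u := fun t => by
    refine (seminorm_le_exp_mul hpq _ (sub_le_self T t.2.1) _).trans ?_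
    refine mul_le_mul_of_nonneg_left ?_ (Real.exp_pos _).le
    rw [Ctb.supSeminorm_apply 𝓢U T _ hpB]
    refine le_ciSup (f := fun t => (p.comp B.toLinearMap) (Ctb.eval 𝓢U T t u))
      ⟨D * ‖u‖, ?_⟩ t
    rintro _ ⟨s, rfl⟩
    exact (hD _).trans (mul_le_mul_of_nonneg_left (Ctb.norm_eval_le 𝓢U u s) hD0.le)
  refine ((inputMap_spec hX hXC hS hB hT u).2 q hq).trans ((Real.le_norm_self _).trans ?_)
  rw [mul_right_comm]
  exact norm_integral_le_of_norm_le_const (Eventually.of_forall fun t => by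
    rw [Real.norm_of_nonneg (apply_nonneg _ _)]; exact hle t)

theorem gammaInfty_tendsto {𝕜 U : Type*} [RCLike 𝕜] [NormedAddCommGroup U] [NormedSpace 𝕜 U]
    [NormedSpace ℝ U] (𝓢 : SaksSpace 𝕜 U) {T : ℝ} (u₀ : Ctb 𝓢 T) {p : Seminorm 𝕜 U}
    (hp : Continuous[𝓢.gamma, inferInstance] p) :
    Tendsto (fun u => Ctb.supSeminorm 𝓢 T p (u - u₀)) (@nhds _ (gammaInfty 𝓢 T) u₀) (𝓝 0) := by
  let F : SeminormFamily 𝕜 (Ctb 𝓢 T) {p : Seminorm 𝕜 U // Continuous[𝓢.gamma, inferInstance] p} :=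
    fun p => Ctb.supSeminorm 𝓢 T p.1
  have hF : @WithSeminorms 𝕜 _ _ _ _ _ F (gammaInfty 𝓢 T) :=
    @WithSeminorms.mk 𝕜 _ _ _ _ _ F (gammaInfty 𝓢 T) rfl
  have h := (@WithSeminorms.tendsto_nhds 𝕜 _ _ _ _ _ _ (gammaInfty 𝓢 T) F hF id
    (@nhds _ (gammaInfty 𝓢 T) u₀) u₀).1 tendsto_id ⟨p, hp⟩
  exact tendsto_order.2
    ⟨fun a ha => Eventually.of_forall fun u => ha.trans_le (apply_nonneg _ _), h⟩

end InputMap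

end SaksControl

theorem mainTheorem9 {𝕜 X U : Type*} [RCLike 𝕜]
    [NormedAddCommGroup X] [NormedSpace 𝕜 X] [NormedSpace ℝ X] [IsScalarTower ℝ 𝕜 X]
    [NormedAddCommGroup U] [NormedSpace 𝕜 U] [NormedSpace ℝ U] [IsScalarTower ℝ 𝕜 U]
    (𝓢X : SaksControl.SaksSpace 𝕜 X) (hX : 𝓢X.SequentiallyComplete) (hXC : 𝓢X.CSequential)
    (𝓢U : SaksControl.SaksSpace 𝕜 U)
    (S : ℝ≥0 → X →L[𝕜] X) (hS : SaksControl.IsLocallyBicontinuousSemigroup 𝓢X S)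
    (B : U →L[𝕜] X) (hB : SaksControl.ContinuousOnBounded 𝓢U 𝓢X B) :
    -- (a) quasi-equicontinuity of the family (S_t B)
    SaksControl.QuasiEquicontinuous 𝓢U.gamma 𝓢X.gamma
      (fun t => ((S t).comp B : U →L[𝕜] X).toLinearMap) ∧
    ∀ T : ℝ, 0 < T →
      -- the integral defining the input map exists, for both topologies
      (∀ u : SaksControl.Ctb 𝓢U T,
        SaksControl.HasPettisIntegral 𝕜 𝓢X.tau (SaksControl.lebesgueIcc T)
          (SaksControl.inputIntegrand 𝓢U S B T u)
          (SaksControl.inputMap 𝓢U 𝓢X S B T u) ∧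
        SaksControl.HasPettisIntegral 𝕜 𝓢X.gamma (SaksControl.lebesgueIcc T)
          (SaksControl.inputIntegrand 𝓢U S B T u)
          (SaksControl.inputMap 𝓢U 𝓢X S B T u)) ∧
      -- (b) the input map is linear and norm-bounded, and continuous for the mixed topologies
      ∃ L : SaksControl.Ctb 𝓢U T →L[𝕜] X,
        (∀ u, L u = SaksControl.inputMap 𝓢U 𝓢X S B T u) ∧
        Continuous[SaksControl.gammaInfty 𝓢U T, 𝓢X.gamma] L ∧
        -- (c) the dual operator maps X° into the dual for the topology of C_{τ,b}([0,T];U)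
        ∀ x' ∈ 𝓢X.circDual,
          Continuous[SaksControl.gammaInfty 𝓢U T, inferInstance] (x'.comp L) := by
  refine ⟨SaksControl.quasiEquicontinuous_comp hS hXC hB, fun T hT => ?_⟩
  have hspec := fun u => SaksControl.inputMap_spec hX hXC hS hB hT u
  have hτ := fun u => (hspec u).1.mono 𝓢X.gamma_le_tau
  refine ⟨fun u => ⟨hτ u, (hspec u).1⟩, ?_⟩
  have := SaksControl.isFiniteMeasure_lebesgueIcc T
  obtain ⟨C, -, hC⟩ := hS.exists_norm_le T
  let L₀ : SaksControl.Ctb 𝓢U T →ₗ[𝕜] X :=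
    { toFun := SaksControl.inputMap 𝓢U 𝓢X S B T
      map_add' := fun u v => by
        -- Linearity follows from uniqueness: both sides are `τ`-Pettis integrals of the same
        -- integrand.
        refine 𝓢X.hasPettisIntegral_unique (hτ (u + v)) ?_
        convert (hτ u).add (hτ v) using 2 with t
        simp [SaksControl.inputIntegrand]
      map_smul' := fun c u => by
        refine 𝓢X.hasPettisIntegral_unique (hτ (c • u)) ?_
        rw [RingHom.id_apply]
        convert (hτ u).smul c using 2 with t
        simp [SaksControl.inputIntegrand] }
  let L : SaksControl.Ctb 𝓢U T →L[𝕜] X :=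
    L₀.mkContinuous (C * ‖B‖ * (SaksControl.lebesgueIcc T).real univ) fun u => by
      refine (𝓢X.norm_le_of_hasPettisIntegral (hτ u)
        (SaksControl.norm_inputIntegrand_le hC u)).trans_eq ?_
      ring
  have hL : Continuous[SaksControl.gammaInfty 𝓢U T, 𝓢X.gamma] L := by
    refine (@continuous_iff_continuousAt _ _ (SaksControl.gammaInfty 𝓢U T) 𝓢X.gamma _).2
      fun u₀ => 𝓢X.tendsto_gamma_iff.2 fun q hq => ?_
    obtain ⟨p, D, hp, hD⟩ := SaksControl.inputMap_seminorm_le hX hXC hS hB hT hq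
    have h := (SaksControl.gammaInfty_tendsto 𝓢U u₀ hp).const_mul D
    rw [mul_zero] at h
    refine squeeze_zero (fun u => apply_nonneg q _) (fun u => ?_) h
    rw [← map_sub]
    exact hD (u - u₀)
  exact ⟨L, fun u => rfl, hL, fun x' hx' =>
    @Continuous.comp _ _ _ (SaksControl.gammaInfty 𝓢U T) 𝓢X.gamma _ _ _
      (hXC.continuous_of_mem_circDual hx') hL⟩
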